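/- Let $L/K$ be a separable algebraic field extension, possibly of infinite degree, and let $N\supseteq L$ be a normal closure of $L/K$. Let $G=\mathrm{Aut}_K(N)$, let $\{L_i\}_{i\in I}$ be the different conjugate fields $g(L)$, $g\in G$, and let $\mathcal G$ be the groupoid with object set $I$ whose morphisms $\sigma$ from $d(\sigma)=j$ to $r(\sigma)=i$ are the field isomorphisms $L_j\to L_i$ that are restrictions of elements of $G$, with composition of maps; we write $L_{d(\sigma)}=L_j$ and $L_{r(\sigma)}=L_i$. Let $\beta$ be a normalized cocycle on $\mathcal G$: for all $\sigma,\tau\in\mathcal G$ with $d(\sigma)=r(\tau)$ there is given $\beta_{\sigma,\tau}\in L_{r(\sigma)}\setminus\{0\}$ such that $\beta_{\sigma,\tau}=1$ whenever $\sigma$ or $\tau$ is an identity, and $\beta_{\sigma,\tau}\,\beta_{\sigma\tau,\rho}=\sigma(\beta_{\tau,\rho})\,\beta_{\sigma,\tau\rho}$ for all composable triples $(\sigma,\tau,\rho)$. The object crossed product $R=(L/K,\beta)$ is the (not necessarily unital) ring $\bigoplus_{\sigma\in\mathcal G}L_{r(\sigma)}u_\sigma$ with the biadditive multiplication determined by $(x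 u_\sigma)(y u_\tau)=x\,\sigma(y)\,\beta_{\sigma,\tau}\,u_{\sigma\tau}$ if $d(\sigma)=r(\tau)$, and $(x u_\sigma)(y u_\tau)=0$ otherwise. Let $R_0=\bigoplus_{i\in I}L_i u_{\mathrm{id}_{L_i}}\subseteq R$. A ring extension $A\supseteq B$ of not necessarily unital rings is called separable if the multiplication map $\mu:A\otimes_B A\to A$ has an $A$-bimodule section, i.e. there is an additive map $\delta:A\to A\otimes_B A$ with $\mu\circ\delta=\mathrm{id}_A$, $\delta(ca)=c\,\delta(a)$ and $\delta(ac)=\delta(a)\,c$ for all $a,c\in A$. Then $R$ is separable over $R_0$ if and only if the group $\mathrm{Aut}_K(L)$ is finite. In particular, if $L/K$ is Galois, then $R_0=L$, that is, $x\mapsto x u_{\mathrm{id}_L}$ is a ring isomorphism from $L$ onto $R_0$, and $R$ is separable over $R_0=L$ if and only if $L/K$ is finite. -/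

import Mathlib

/-! ### Separable extensions of (not necessarily unital) rings -/

namespace RingExt

open TensorProduct

variable {A : Type*} [NonUnitalRing A]

/-- The subgroup of `A ⊗_ℤ A` generated by all `ab ⊗ a' - a ⊗ ba'` with `b ∈ B`. -/
def balancing (B : NonUnitalSubring A) : AddSubgroup (A ⊗[ℤ] A) :=
  AddSubgroup.closure
    {z | ∃ a a' b : A, b ∈ B ∧ z = (a * b) ⊗ₜ[ℤ] a' - a ⊗ₜ[ℤ] (b * a')}

/-- The tensor product `A ⊗_B A` of the right `B`-module `A` and the left `B`-module `A`,
as an additive group. -/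
abbrev Tensor (B : NonUnitalSubring A) : Type _ := (A ⊗[ℤ] A) ⧸ balancing B

/-- The pure tensor `a ⊗ a'` in `A ⊗_B A`. -/
def tmul (B : NonUnitalSubring A) (a a' : A) : Tensor B :=
  QuotientAddGroup.mk (a ⊗ₜ[ℤ] a')

theorem tmul_balanced (B : NonUnitalSubring A) (a a' : A) {b : A} (hb : b ∈ B) :
    tmul B (a * b) a' = tmul B a (b * a') := by
  unfold tmul
  rw [← sub_eq_zero, ← QuotientAddGroup.mk_sub, QuotientAddGroup.eq_zero_iff]
  exact AddSubgroup.subset_closure ⟨a, a', b, hb, rfl⟩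

/-- The left action of `A` on `A ⊗_B A`: `c • (a ⊗ a') = ca ⊗ a'`. -/
def lact (B : NonUnitalSubring A) (c : A) : Tensor B →+ Tensor B :=
  QuotientAddGroup.map (balancing B) (balancing B)
    (TensorProduct.map (AddMonoidHom.mulLeft c).toIntLinearMap
      (LinearMap.id : A →ₗ[ℤ] A)).toAddMonoidHom (by
    refine (AddSubgroup.closure_le _).2 ?_
    rintro z ⟨a, a', b, hb, rfl⟩
    refine AddSubgroup.subset_closure ⟨c * a, a', b, hb, ?_⟩
    simp [mul_assoc])

/-- The right action of `A` on `A ⊗_B A`: `(a ⊗ a') • c = a ⊗ a'c`. -/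
def ract (B : NonUnitalSubring A) (c : A) : Tensor B →+ Tensor B :=
  QuotientAddGroup.map (balancing B) (balancing B)
    (TensorProduct.map (LinearMap.id : A →ₗ[ℤ] A)
      (AddMonoidHom.mulRight c).toIntLinearMap).toAddMonoidHom (by
    refine (AddSubgroup.closure_le _).2 ?_
    rintro z ⟨a, a', b, hb, rfl⟩
    refine AddSubgroup.subset_closure ⟨a, a' * c, b, hb, ?_⟩
    simp [mul_assoc])

/-- The multiplication map `μ : A ⊗_B A → A`, `a ⊗ a' ↦ aa'`. -/
def mu (B : NonUnitalSubring A) : Tensor B →+ A :=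
  QuotientAddGroup.lift (balancing B)
    (TensorProduct.lift
      (AddMonoidHom.toIntLinearMap
        ({ toFun := fun a => (AddMonoidHom.mulLeft a).toIntLinearMap
           map_zero' := by ext; simp
           map_add' := fun a a' => by ext; simp [add_mul] } : A →+ (A →ₗ[ℤ] A)))).toAddMonoidHom (by
    refine (AddSubgroup.closure_le _).2 ?_
    rintro z ⟨a, a', b, hb, rfl⟩
    simp [mul_assoc])

@[simp] theorem lact_tmul (B : NonUnitalSubring A) (c a a' : A) :
    lact B c (tmul B a a') = tmul B (c * a) a' := rfl

@[simp] theorem ract_tmul (B : NonUnitalSubring A) (c a a' : A) :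
    ract B c (tmul B a a') = tmul B a (a' * c) := rfl

@[simp] theorem mu_tmul (B : NonUnitalSubring A) (a a' : A) :
    mu B (tmul B a a') = a * a' := rfl

/-- The ring extension `A/B` is separable: the multiplication map `μ : A ⊗_B A → A` has an
`A`-bimodule section `δ : A → A ⊗_B A`. -/
def IsSeparable (B : NonUnitalSubring A) : Prop :=
  ∃ δ : A →+ Tensor B,
    (∀ a, mu B (δ a) = a) ∧
    (∀ c a, δ (c * a) = lact B c (δ a)) ∧
    (∀ a c, δ (a * c) = ract B c (δ a))

end RingExt

/-! ### Object crossed systems and object crossed products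

A groupoid is a category `C` with invertible morphisms, whose objects are the units `e`.
A morphism `σ : e ⟶ f` has domain `d(σ) = e` and range `r(σ) = f`, and the product `στ`
(first `τ`, then `σ`) is `τ ≫ σ`. -/

open CategoryTheory in
/-- An object crossed system over a groupoid `C` with coefficient rings `A e`. -/
structure ObjectCrossedSystem (C : Type*) [Groupoid C] (A : C → Type*) [∀ e, Ring (A e)] where
  nontrivial : ∀ e, Nontrivial (A e)
  /-- the weak action -/
  α : ∀ {e f : C}, (e ⟶ f) → (A e ≃+* A f)
  /-- the cocycle -/
  β : ∀ {e f g : C}, (f ⟶ g) → (e ⟶ f) → (A g)ˣ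
  α_id : ∀ e : C, α (𝟙 e) = RingEquiv.refl (A e)
  β_right_id : ∀ {e f : C} (σ : e ⟶ f), β σ (𝟙 e) = 1
  β_left_id : ∀ {e f : C} (σ : e ⟶ f), β (𝟙 f) σ = 1
  α_α : ∀ {e f g : C} (σ : f ⟶ g) (τ : e ⟶ f) (a : A e),
    α σ (α τ a) = (β σ τ : A g) * α (τ ≫ σ) a * ((β σ τ)⁻¹ : (A g)ˣ)
  cocycle : ∀ {e f g h : C} (σ : g ⟶ h) (τ : f ⟶ g) (ρ : e ⟶ f),
    (β σ τ : A h) * β (τ ≫ σ) ρ = α σ (β τ ρ) * β σ (ρ ≫ τ)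

namespace ObjectCrossedSystem

open CategoryTheory

variable {C : Type*} [Groupoid C] {A : C → Type*} [∀ e, Ring (A e)]

/-- The underlying set of the object crossed product: finite formal sums `∑ a_σ u_σ` with
`a_σ ∈ A_{r(σ)}`, where `σ` runs through all morphisms of `C`. -/
def Product (_S : ObjectCrossedSystem C A) : Type _ :=
  DirectSum (Σ e f : C, (e ⟶ f)) (fun s => A s.2.1)

variable (S : ObjectCrossedSystem C A)

noncomputable instance : AddCommGroup S.Product :=
  inferInstanceAs (AddCommGroup (DirectSum (Σ e f : C, (e ⟶ f)) (fun s => A s.2.1)))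

open Classical in
/-- The homogeneous element `a u_σ`. -/
noncomputable def single {e f : C} (σ : e ⟶ f) : A f →+ S.Product :=
  DirectSum.of (fun s : (Σ e f : C, (e ⟶ f)) => A s.2.1) ⟨e, f, σ⟩

/-- The product `(a u_σ)(b u_τ) = a α_σ(b) β_{σ,τ} u_{στ}` for a composable pair. -/
noncomputable def compMul {e f g : C} (σ : f ⟶ g) (τ : e ⟶ f) : A g →+ A f →+ S.Product where
  toFun a := (S.single (τ ≫ σ)).comp
    (((AddMonoidHom.mulRight (S.β σ τ : A g)).comp (AddMonoidHom.mulLeft a)).comp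
      (S.α σ : A f →+* A g).toAddMonoidHom)
  map_zero' := by ext; simp
  map_add' a b := by ext; simp [add_mul]

theorem compMul_apply {e f g : C} (σ : f ⟶ g) (τ : e ⟶ f) (a : A g) (b : A f) :
    S.compMul σ τ a b = S.single (τ ≫ σ) (a * S.α σ b * S.β σ τ) := rfl

open Classical in
/-- The product of `a u_σ` and `b u_τ` for arbitrary morphisms `σ`, `τ`; it is zero if
`σ τ` is not defined. If `d(σ)` and `r(τ)` are equal, then `eqToHom` is an identity morphism. -/
noncomputable def homMul (s t : Σ e f : C, (e ⟶ f)) : A s.2.1 →+ A t.2.1 →+ S.Product :=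
  if h : t.2.1 = s.1 then S.compMul (eqToHom h ≫ s.2.2) t.2.2 else 0

open Classical in
/-- The additive extension to `R` of additive maps `A_{r(σ)} u_σ → M`. -/
noncomputable def liftHom {M : Type*} [AddCommMonoid M]
    (φ : ∀ s : (Σ e f : C, (e ⟶ f)), A s.2.1 →+ M) : S.Product →+ M :=
  DirectSum.toAddMonoid φ

theorem liftHom_single {M : Type*} [AddCommMonoid M]
    (φ : ∀ s : (Σ e f : C, (e ⟶ f)), A s.2.1 →+ M) {e f : C} (σ : e ⟶ f) (a : A f) :
    S.liftHom φ (S.single σ a) = φ ⟨e, f, σ⟩ a := by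
  classical
  exact DirectSum.toAddMonoid_of φ ⟨e, f, σ⟩ a

/-- The multiplication of the object crossed product: the biadditive extension of `homMul`. -/
noncomputable def mulHom : S.Product →+ S.Product →+ S.Product :=
  S.liftHom fun s => (S.liftHom fun t => (S.homMul s t).flip).flip

theorem mulHom_single {e f e' f' : C} (σ : e ⟶ f) (τ : e' ⟶ f') (a : A f) (b : A f') :
    S.mulHom (S.single σ a) (S.single τ b) = S.homMul ⟨e, f, σ⟩ ⟨e', f', τ⟩ a b := by
  rw [mulHom, liftHom_single, AddMonoidHom.flip_apply, liftHom_single, AddMonoidHom.flip_apply]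

theorem mulHom_single_comp {e f g : C} (σ : f ⟶ g) (τ : e ⟶ f) (a : A g) (b : A f) :
    S.mulHom (S.single σ a) (S.single τ b) =
      S.single (τ ≫ σ) (a * S.α σ b * S.β σ τ) := by
  rw [mulHom_single, homMul, dif_pos rfl]
  simp [compMul_apply]

theorem mulHom_single_zero {e f e' f' : C} (σ : e ⟶ f) (τ : e' ⟶ f') (a : A f) (b : A f')
    (h : f' ≠ e) : S.mulHom (S.single σ a) (S.single τ b) = 0 := by
  rw [mulHom_single, homMul, dif_neg h]
  rfl

theorem induction {p : S.Product → Prop} (x : S.Product) (h0 : p 0)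
    (h1 : ∀ {e f : C} (σ : e ⟶ f) (a : A f), p (S.single σ a))
    (h2 : ∀ x y, p x → p y → p (x + y)) : p x := by
  classical
  exact DirectSum.induction_on x h0 (fun s a => h1 s.2.2 a) h2

theorem mulHom_assoc (x y z : S.Product) :
    S.mulHom (S.mulHom x y) z = S.mulHom x (S.mulHom y z) := by
  induction x using S.induction with
  | h0 => simp
  | h2 x₁ x₂ h₁ h₂ => simp only [map_add, AddMonoidHom.add_apply, h₁, h₂]
  | h1 σ a =>
    rename_i e₁ f₁
    induction y using S.induction with
    | h0 => simp
    | h2 x₁ x₂ h₁ h₂ => simp only [map_add, AddMonoidHom.add_apply, h₁, h₂]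
    | h1 τ b =>
      rename_i e₂ f₂
      induction z using S.induction with
      | h0 => simp
      | h2 x₁ x₂ h₁ h₂ => simp only [map_add, h₁, h₂]
      | h1 ρ c =>
        rename_i e₃ f₃
        by_cases h12 : f₂ = e₁
        · subst h12
          rw [mulHom_single_comp]
          by_cases h23 : f₃ = e₂
          · subst h23
            rw [mulHom_single_comp, mulHom_single_comp, mulHom_single_comp, Category.assoc]
            congr 1
            have hc := S.cocycle σ τ ρ
            simp only [map_mul, S.α_α, mul_assoc]
            rw [← hc]
            simp
          · rw [mulHom_single_zero _ _ _ _ _ h23, mulHom_single_zero _ _ _ _ _ h23, map_zero]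
        · rw [mulHom_single_zero _ _ _ _ _ h12, map_zero, AddMonoidHom.zero_apply]
          by_cases h23 : f₃ = e₂
          · subst h23
            rw [mulHom_single_comp, mulHom_single_zero _ _ _ _ _ h12]
          · rw [mulHom_single_zero _ _ _ _ _ h23, map_zero]

noncomputable instance : NonUnitalRing S.Product :=
  { (inferInstance : AddCommGroup S.Product) with
    mul := fun x y => S.mulHom x y
    left_distrib := fun x y z => map_add (S.mulHom x) y z
    right_distrib := fun x y z => by
      change S.mulHom (x + y) z = S.mulHom x z + S.mulHom y z
      rw [map_add, AddMonoidHom.add_apply]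
    zero_mul := fun x => by
      change S.mulHom 0 x = 0
      rw [map_zero, AddMonoidHom.zero_apply]
    mul_zero := fun x => map_zero (S.mulHom x)
    mul_assoc := S.mulHom_assoc }

/-- `(a u_σ)(b u_τ) = a α_σ(b) β_{σ,τ} u_{στ}` if `σ τ` is defined. -/
theorem single_mul_single {e f g : C} (σ : f ⟶ g) (τ : e ⟶ f) (a : A g) (b : A f) :
    S.single σ a * S.single τ b = S.single (τ ≫ σ) (a * S.α σ b * S.β σ τ) :=
  S.mulHom_single_comp σ τ a b

/-- `(a u_σ)(b u_τ) = 0` if `σ τ` is not defined. -/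
theorem single_mul_single_zero {e f e' f' : C} (σ : e ⟶ f) (τ : e' ⟶ f') (a : A f) (b : A f')
    (h : f' ≠ e) : S.single σ a * S.single τ b = 0 :=
  S.mulHom_single_zero σ τ a b h

/-- The principal component `R_0 = ⊕_e R_e` of the object crossed product `R`, where
`R_e = A_e u_e` and `e` runs through the objects (identified with the identity morphisms). -/
noncomputable def principal : NonUnitalSubring S.Product :=
  { (⨆ e : C, (S.single (𝟙 e)).range : AddSubgroup S.Product) with
    mul_mem' := by
      intro x y hx hy
      change x ∈ (⨆ e : C, (S.single (𝟙 e)).range : AddSubgroup S.Product) at hx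
      change y ∈ (⨆ e : C, (S.single (𝟙 e)).range : AddSubgroup S.Product) at hy
      change x * y ∈ (⨆ e : C, (S.single (𝟙 e)).range : AddSubgroup S.Product)
      induction hx using AddSubgroup.iSup_induction' with
      | h1 => rw [zero_mul]; exact zero_mem _
      | hadd x₁ x₂ _ _ h₁ h₂ => rw [add_mul]; exact add_mem h₁ h₂
      | hp e x hx =>
        obtain ⟨a, rfl⟩ := hx
        induction hy using AddSubgroup.iSup_induction' with
        | h1 => rw [mul_zero]; exact zero_mem _
        | hadd y₁ y₂ _ _ h₁ h₂ => rw [mul_add]; exact add_mem h₁ h₂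
        | hp f y hy =>
          obtain ⟨b, rfl⟩ := hy
          by_cases h : f = e
          · subst h
            rw [single_mul_single, Category.comp_id]
            exact AddSubgroup.mem_iSup_of_mem f ⟨_, rfl⟩
          · rw [single_mul_single_zero _ _ _ _ _ h]
            exact zero_mem _ }

theorem single_id_mem_principal (e : C) (a : A e) : S.single (𝟙 e) a ∈ S.principal :=
  AddSubgroup.mem_iSup_of_mem (S := fun e : C => (S.single (𝟙 e)).range) e ⟨a, rfl⟩

end ObjectCrossedSystem

/-! ### The object crossed product of a separable field extension -/

/-- The conjugate fields of `L` in the extension `N` of `L`, under the action of the group of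
`K`-automorphisms of `N`. -/
def ConjugateField (K L N : Type*) [Field K] [Field L] [Field N] [Algebra K L] [Algebra K N]
    [Algebra L N] [IsScalarTower K L N] : Type _ :=
  {F : IntermediateField K N //
    ∃ g : N ≃ₐ[K] N, F = (IsScalarTower.toAlgHom K L N).fieldRange.map (g : N →ₐ[K] N)}

namespace ConjugateField

open CategoryTheory

variable {K L N : Type*} [Field K] [Field L] [Field N] [Algebra K L] [Algebra K N]
  [Algebra L N] [IsScalarTower K L N]

/-- The conjugate field as a type. -/
abbrev Carrier (i : ConjugateField K L N) : Type _ := i.1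

/-- The isomorphisms `L_j → L_i` that are restrictions of `K`-automorphisms of `N`. -/
abbrev Iso (j i : ConjugateField K L N) : Type _ :=
  {σ : j.Carrier ≃ₐ[K] i.Carrier // ∃ g : N ≃ₐ[K] N, ∀ x : j.Carrier, (σ x : N) = g (x : N)}

/-- The groupoid of isomorphisms between the conjugate fields of `L`. -/
instance : Groupoid (ConjugateField K L N) where
  Hom j i := Iso j i
  id j := ⟨AlgEquiv.refl, AlgEquiv.refl, fun _ => rfl⟩
  comp σ τ := ⟨σ.1.trans τ.1, by
    obtain ⟨σ, g, hg⟩ := σ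
    obtain ⟨τ, h, hh⟩ := τ
    exact ⟨g.trans h, fun x => by simp [hg, hh]⟩⟩
  inv σ := ⟨σ.1.symm, by
    obtain ⟨σ, g, hg⟩ := σ
    refine ⟨g.symm, fun x => ?_⟩
    rw [AlgEquiv.eq_symm_apply, ← hg]
    simp⟩
  inv_comp σ := Subtype.ext (AlgEquiv.ext fun x => σ.1.apply_symm_apply x)
  comp_inv σ := Subtype.ext (AlgEquiv.ext fun x => σ.1.symm_apply_apply x)

/-- The field `L` itself (embedded in `N`), as one of its conjugates. -/
def base (K L N : Type*) [Field K] [Field L] [Field N] [Algebra K L] [Algebra K N]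
    [Algebra L N] [IsScalarTower K L N] : ConjugateField K L N :=
  ⟨(IsScalarTower.toAlgHom K L N).fieldRange, AlgEquiv.refl,
    (IntermediateField.map_id _).symm⟩

/-- An element of `L` as an element of the copy of `L` in `N`. -/
def toBase (K : Type*) {L : Type*} (N : Type*) [Field K] [Field L] [Field N] [Algebra K L]
    [Algebra K N] [Algebra L N] [IsScalarTower K L N] (x : L) : (base K L N).Carrier :=
  ⟨algebraMap L N x, x, rfl⟩

end ConjugateField

open CategoryTheory in
/-- A normalized cocycle `β` on the groupoid of isomorphisms between the conjugates of `L`: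
`β_{σ,τ} ∈ L_{r(σ)} ∖ {0}` for every composable pair `(σ, τ)`. -/
structure FieldCocycle (K L N : Type*) [Field K] [Field L] [Field N] [Algebra K L] [Algebra K N]
    [Algebra L N] [IsScalarTower K L N] where
  β : ∀ {e f g : ConjugateField K L N}, (f ⟶ g) → (e ⟶ f) → g.Carrierˣ
  β_right_id : ∀ {e f : ConjugateField K L N} (σ : e ⟶ f), β σ (𝟙 e) = 1
  β_left_id : ∀ {e f : ConjugateField K L N} (σ : e ⟶ f), β (𝟙 f) σ = 1
  cocycle : ∀ {e f g h : ConjugateField K L N} (σ : g ⟶ h) (τ : f ⟶ g) (ρ : e ⟶ f),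
    (β σ τ : h.Carrier) * β (τ ≫ σ) ρ = σ.1 (β τ ρ : g.Carrier) * β σ (ρ ≫ τ)

namespace FieldCocycle

variable {K L N : Type*} [Field K] [Field L] [Field N] [Algebra K L] [Algebra K N]
  [Algebra L N] [IsScalarTower K L N]

/-- The object crossed system given by the conjugates of `L`, the groupoid of isomorphisms
between them, its natural action `α_σ = σ`, and the cocycle `β`. -/
def system (c : FieldCocycle K L N) :
    ObjectCrossedSystem (ConjugateField K L N) ConjugateField.Carrier where
  nontrivial _ := inferInstance
  α σ := σ.1.toRingEquiv
  β := c.β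
  α_id _ := rfl
  β_right_id := c.β_right_id
  β_left_id := c.β_left_id
  α_α σ τ a := by
    rw [mul_right_comm, Units.mul_inv, one_mul]
    rfl
  cocycle := c.cocycle

/-- The object crossed product `(L/K, β)`. -/
abbrev Crossed (c : FieldCocycle K L N) : Type _ := c.system.Product

end FieldCocycle

/-!
Separability of `R/R_0` amounts to a choice, for each object `e`, of an element
`X_e ∈ u_e (R ⊗_{R_0} R) u_e` with `μ(X_e) = u_e` and `r X_{d(σ)} = X_{r(σ)} r` for all `r` in the
component of `σ`; the section is `r ↦ r X_{d(σ)}`.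

Necessity (`ObjectCrossedSystem.finite_end_of_isSeparable`) holds for every object crossed system.
The components of `R` are right `R_0`-modules, so projecting the left tensor factor onto the
component of `σ` and multiplying is a well-defined map on `R ⊗_{R_0} R`. At a given element only
finitely many of these maps are nonzero, and they add up to `μ`. For `X_e` the set of `σ` with
nonzero value is therefore finite and nonempty; the identity `u_g X_e = X_e u_g` makes it stable
under `σ ↦ gσ` for `g` in the isotropy group of `e`, which acts freely. So that group is finite.

For sufficiency (`ObjectCrossedSystem.isSeparable_of_sum_eq_one`), only morphisms out of one fixed
object `e₀` are used: `X_e = ∑_{σ : e₀ ⟶ e} u_σ a ⊗ u_σ⁻¹`, a finite sum when the groupoid is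
connected with finite isotropy groups. The condition `μ(X_e) = u_e` becomes `∑_σ σ(a) = 1`. For
`e = e₀` it asks for an element of trace one for a finite group of field automorphisms, which
exists by Dedekind's independence of characters (`AlgEquiv.exists_sum_eq_one`); the other objects
follow by applying one isomorphism `e₀ ⟶ e`.

The groupoid of conjugates of `L` is connected, and by normality of `N/K` its isotropy group at `L`
is the whole of `Aut_K(L)`. If `L/K` is Galois, then `L` is its only object, and `Aut_K(L)` is
finite exactly when `L/K` is finite, since the Krull topology on a finite group is discrete.
-/

/-! ### Maps on the tensor product -/

namespace RingExt

open TensorProduct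

variable {A : Type*} [NonUnitalRing A]

/-- The map `f ⊗ id` on `A ⊗_B A`, for a right `B`-linear map `f : A → A`. -/
def mapLeft (B : NonUnitalSubring A) (f : A →+ A) (hf : ∀ a, ∀ b ∈ B, f (a * b) = f a * b) :
    Tensor B →+ Tensor B :=
  QuotientAddGroup.map (balancing B) (balancing B)
    (TensorProduct.map f.toIntLinearMap (LinearMap.id : A →ₗ[ℤ] A)).toAddMonoidHom (by
    refine (AddSubgroup.closure_le _).2 ?_
    rintro z ⟨a, a', b, hb, rfl⟩
    refine AddSubgroup.subset_closure ⟨f a, a', b, hb, ?_⟩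
    simp [hf a b hb])

@[simp] theorem mapLeft_tmul (B : NonUnitalSubring A) (f : A →+ A)
    (hf : ∀ a, ∀ b ∈ B, f (a * b) = f a * b) (a a' : A) :
    mapLeft B f hf (tmul B a a') = tmul B (f a) a' := rfl

theorem tmul_add_left (B : NonUnitalSubring A) (a₁ a₂ b : A) :
    tmul B (a₁ + a₂) b = tmul B a₁ b + tmul B a₂ b := by
  simp only [tmul, add_tmul, QuotientAddGroup.mk_add]

@[simp] theorem tmul_zero_left (B : NonUnitalSubring A) (b : A) : tmul B 0 b = 0 := by
  simp only [tmul, zero_tmul, QuotientAddGroup.mk_zero]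

@[simp] theorem tmul_zero_right (B : NonUnitalSubring A) (b : A) : tmul B b 0 = 0 := by
  simp only [tmul, tmul_zero, QuotientAddGroup.mk_zero]

theorem Tensor.induction {B : NonUnitalSubring A} {p : Tensor B → Prop} (z : Tensor B)
    (h0 : p 0) (ht : ∀ a a', p (tmul B a a')) (ha : ∀ x y, p x → p y → p (x + y)) : p z := by
  obtain ⟨z, rfl⟩ := QuotientAddGroup.mk_surjective z
  induction z using TensorProduct.induction_on with
  | zero => exact h0
  | tmul a a' => exact ht a a'
  | add x y hx hy => exact ha _ _ hx hy

theorem lact_mul (B : NonUnitalSubring A) (c d : A) (z : Tensor B) :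
    lact B (c * d) z = lact B c (lact B d z) := by
  induction z using Tensor.induction with
  | h0 => simp
  | ht a a' => simp [mul_assoc]
  | ha x y hx hy => simp [hx, hy]

theorem lact_ract (B : NonUnitalSubring A) (c d : A) (z : Tensor B) :
    lact B c (ract B d z) = ract B d (lact B c z) := by
  induction z using Tensor.induction with
  | h0 => simp
  | ht a a' => simp
  | ha x y hx hy => simp [hx, hy]

theorem lact_add (B : NonUnitalSubring A) (c d : A) (z : Tensor B) :
    lact B (c + d) z = lact B c z + lact B d z := by
  induction z using Tensor.induction with
  | h0 => simp
  | ht a a' => simp [add_mul, tmul_add_left]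
  | ha x y hx hy => simp only [map_add, hx, hy]; abel

theorem ract_add (B : NonUnitalSubring A) (c d : A) (z : Tensor B) :
    ract B (c + d) z = ract B c z + ract B d z := by
  induction z using Tensor.induction with
  | h0 => simp
  | ht a a' => simp only [ract_tmul, mul_add]; simp only [tmul, tmul_add, QuotientAddGroup.mk_add]
  | ha x y hx hy => simp only [map_add, hx, hy]; abel

@[simp] theorem lact_zero (B : NonUnitalSubring A) (z : Tensor B) : lact B 0 z = 0 := by
  simpa using lact_add B 0 0 z

@[simp] theorem ract_zero (B : NonUnitalSubring A) (z : Tensor B) : ract B 0 z = 0 := by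
  simpa using ract_add B 0 0 z

theorem mu_lact (B : NonUnitalSubring A) (c : A) (z : Tensor B) :
    mu B (lact B c z) = c * mu B z := by
  induction z using Tensor.induction with
  | h0 => simp
  | ht a a' => simp [mul_assoc]
  | ha x y hx hy => simp [hx, hy, mul_add]

theorem mu_mapLeft_ract (B : NonUnitalSubring A) (f : A →+ A)
    (hf : ∀ a, ∀ b ∈ B, f (a * b) = f a * b) (c : A) (z : Tensor B) :
    mu B (mapLeft B f hf (ract B c z)) = mu B (mapLeft B f hf z) * c := by
  induction z using Tensor.induction with
  | h0 => simp
  | ht a a' => simp [mul_assoc]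
  | ha x y hx hy => simp [hx, hy, add_mul]

theorem mu_mapLeft_lact (B : NonUnitalSubring A) (f g : A →+ A)
    (hf : ∀ a, ∀ b ∈ B, f (a * b) = f a * b) (hg : ∀ a, ∀ b ∈ B, g (a * b) = g a * b) (c : A)
    (h : ∀ a, f (c * a) = c * g a) (z : Tensor B) :
    mu B (mapLeft B f hf (lact B c z)) = c * mu B (mapLeft B g hg z) := by
  induction z using Tensor.induction with
  | h0 => simp
  | ht a a' => simp [h, mul_assoc]
  | ha x y hx hy => simp [hx, hy, mul_add]

end RingExt

namespace ObjectCrossedSystem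

open CategoryTheory RingExt

variable {C : Type*} [Groupoid C] {A : C → Type*} [∀ e, Ring (A e)]
  (S : ObjectCrossedSystem C A)

/-! ### Homogeneous elements of an object crossed product -/

theorem single_id_mul_single {e f : C} (σ : e ⟶ f) (a b : A f) :
    S.single (𝟙 f) a * S.single σ b = S.single σ (a * b) := by
  rw [single_mul_single, S.α_id, S.β_left_id, Category.comp_id]
  simp

theorem single_mul_single_id {e f : C} (σ : e ⟶ f) (a : A f) (b : A e) :
    S.single σ a * S.single (𝟙 e) b = S.single σ (a * S.α σ b) := by
  rw [single_mul_single, S.β_right_id, Category.id_comp]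
  simp

/-- Each `u_σ` has a two-sided inverse in `A_{d(σ)} u_{σ⁻¹}`, relative to the local units
`u_{d(σ)}` and `u_{r(σ)}`. -/
theorem exists_single_inv {e f : C} (σ : e ⟶ f) : ∃ v : A e,
    S.single (Groupoid.inv σ) v * S.single σ 1 = S.single (𝟙 e) 1 ∧
    S.single σ 1 * S.single (Groupoid.inv σ) v = S.single (𝟙 f) 1 := by
  set w : A e := ↑(S.β (Groupoid.inv σ) σ)⁻¹ with hw
  set v : A e := (S.α σ).symm ↑(S.β σ (Groupoid.inv σ))⁻¹ with hv
  have h₁ : S.single (Groupoid.inv σ) w * S.single σ 1 = S.single (𝟙 e) 1 := by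
    rw [single_mul_single, Groupoid.comp_inv]; simp [hw]
  have h₂ : S.single σ 1 * S.single (Groupoid.inv σ) v = S.single (𝟙 f) 1 := by
    rw [single_mul_single, Groupoid.inv_comp]; simp [hv]
  -- a left inverse and a right inverse agree
  have h₃ : S.single (Groupoid.inv σ) w = S.single (Groupoid.inv σ) v := by
    calc S.single (Groupoid.inv σ) w
        = S.single (Groupoid.inv σ) w * S.single (𝟙 f) 1 := by
          rw [single_mul_single_id]; simp
      _ = S.single (Groupoid.inv σ) v := by
          rw [← h₂, ← mul_assoc, h₁, single_id_mul_single, one_mul]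
  exact ⟨v, h₃ ▸ h₁, h₂⟩

theorem single_injective {e f : C} (σ : e ⟶ f) : Function.Injective (S.single σ) := by
  classical
  exact DirectSum.of_injective (β := fun s : (Σ e f : C, (e ⟶ f)) => A s.2.1) ⟨e, f, σ⟩

open Classical in
/-- The projection of `R` onto its component `A_{r(σ)} u_σ`. -/
noncomputable def proj (s : Σ e f : C, (e ⟶ f)) : S.Product →+ S.Product :=
  S.liftHom fun t => if t = s then S.single t.2.2 else 0

open Classical in
theorem proj_single (s : Σ e f : C, (e ⟶ f)) {e f : C} (σ : e ⟶ f) (a : A f) :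
    S.proj s (S.single σ a) = if (⟨e, f, σ⟩ : Σ e f : C, (e ⟶ f)) = s then S.single σ a else 0 := by
  rw [proj, liftHom_single]
  split_ifs <;> rfl

/-- The components of `R` are right `R_0`-submodules. -/
theorem proj_mul_principal (s : Σ e f : C, (e ⟶ f)) (x b : S.Product) (hb : b ∈ S.principal) :
    S.proj s (x * b) = S.proj s x * b := by
  change b ∈ (⨆ e : C, (S.single (𝟙 e)).range : AddSubgroup S.Product) at hb
  induction hb using AddSubgroup.iSup_induction' with
  | h1 => simp
  | hadd b₁ b₂ _ _ h₁ h₂ => simp [mul_add, h₁, h₂]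
  | hp d b hb =>
    obtain ⟨b, rfl⟩ := hb
    induction x using S.induction with
    | h0 => simp
    | h2 x y hx hy => simp [add_mul, hx, hy]
    | @h1 e f σ a =>
      by_cases h : d = e
      · subst h
        rw [single_mul_single_id, proj_single, proj_single]
        split_ifs
        · rw [single_mul_single_id]
        · simp
      · rw [single_mul_single_zero _ _ _ _ _ h, proj_single]
        split_ifs
        · rw [single_mul_single_zero _ _ _ _ _ h, map_zero]
        · simp

/-- Left multiplication by `c u_g` maps the component of `σ` to the component of `gσ`, and no
other component to it. -/
theorem proj_single_mul {d e f : C} (g : e ⟶ f) (c : A f) (σ : d ⟶ e) (x : S.Product) :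
    S.proj ⟨d, f, σ ≫ g⟩ (S.single g c * x) = S.single g c * S.proj ⟨d, e, σ⟩ x := by
  induction x using S.induction with
  | h0 => simp
  | h2 x y hx hy => simp [mul_add, hx, hy]
  | @h1 d' e' τ a =>
    by_cases h : e' = e
    · subst h
      rw [single_mul_single, proj_single, proj_single]
      by_cases hτ : (⟨d', e', τ⟩ : Σ e f : C, (e ⟶ f)) = ⟨d, e', σ⟩
      · cases hτ
        rw [if_pos rfl, if_pos rfl, single_mul_single]
      · rw [if_neg hτ, if_neg, mul_zero]
        intro hg
        apply hτ
        obtain rfl : d' = d := congrArg Sigma.fst hg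
        obtain rfl : τ = σ := by
          rw [← cancel_mono g]
          simpa using hg
        rfl
    · rw [single_mul_single_zero _ _ _ _ _ h, proj_single, if_neg, mul_zero, map_zero]
      intro hτ
      cases hτ
      exact h rfl

/-! ### Necessity: separability forces finite isotropy groups -/

/-- The map `x ⊗ y ↦ p_σ(x) y`, where `p_σ` is the projection onto the component of `σ`. -/
noncomputable def compMu (s : Σ e f : C, (e ⟶ f)) : Tensor S.principal →+ S.Product :=
  (mu S.principal).comp (mapLeft S.principal (S.proj s) (S.proj_mul_principal s))

theorem compMu_lact {d e f : C} (g : e ⟶ f) (c : A f) (σ : d ⟶ e) (z : Tensor S.principal) :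
    S.compMu ⟨d, f, σ ≫ g⟩ (lact S.principal (S.single g c) z) =
      S.single g c * S.compMu ⟨d, e, σ⟩ z :=
  mu_mapLeft_lact _ _ _ _ _ _ (S.proj_single_mul g c σ) z

theorem compMu_ract (s : Σ e f : C, (e ⟶ f)) (r : S.Product) (z : Tensor S.principal) :
    S.compMu s (ract S.principal r z) = S.compMu s z * r :=
  mu_mapLeft_ract _ _ _ _ _

theorem single_id_mul_compMu {d f : C} (σ : d ⟶ f) (z : Tensor S.principal) :
    S.single (𝟙 f) 1 * S.compMu ⟨d, f, σ⟩ z = S.compMu ⟨d, f, σ⟩ z := by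
  have key (x : S.Product) : S.single (𝟙 f) 1 * S.proj ⟨d, f, σ⟩ x = S.proj ⟨d, f, σ⟩ x := by
    induction x using S.induction with
    | h0 => simp
    | h2 x y hx hy => simp [mul_add, hx, hy]
    | @h1 d' f' τ a =>
      rw [proj_single]
      split_ifs with h
      · cases h
        rw [single_id_mul_single, one_mul]
      · rw [mul_zero]
  induction z using Tensor.induction with
  | h0 => simp
  | ht x y => simp [compMu, ← mul_assoc, key]
  | ha x y hx hy => simp [mul_add, hx, hy]

/-- For a family of additive maps `φ i` and an additive map `ψ`, the elements at which the family
is finitely supported with sum `ψ` are closed under addition. -/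
theorem _root_.AddMonoidHom.exists_sum_eq_add {ι M R : Type*} [AddCommMonoid M] [AddCommMonoid R]
    (φ : ι → M →+ R) (ψ : M →+ R) {x y : M}
    (hx : ∃ F : Finset ι, (∀ i ∉ F, φ i x = 0) ∧ ∑ i ∈ F, φ i x = ψ x)
    (hy : ∃ F : Finset ι, (∀ i ∉ F, φ i y = 0) ∧ ∑ i ∈ F, φ i y = ψ y) :
    ∃ F : Finset ι, (∀ i ∉ F, φ i (x + y) = 0) ∧ ∑ i ∈ F, φ i (x + y) = ψ (x + y) := by
  classical
  obtain ⟨F, hF, hF'⟩ := hx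
  obtain ⟨G, hG, hG'⟩ := hy
  refine ⟨F ∪ G, fun i hi => ?_, ?_⟩
  · rw [Finset.mem_union, not_or] at hi
    rw [map_add, hF i hi.1, hG i hi.2, add_zero]
  · simp only [map_add, Finset.sum_add_distrib]
    rw [← Finset.sum_subset Finset.subset_union_left fun i _ h => hF i h, hF',
      ← Finset.sum_subset (Finset.subset_union_right (s₁ := F)) fun i _ h => hG i h, hG']

theorem exists_sum_proj (x : S.Product) : ∃ F : Finset (Σ e f : C, (e ⟶ f)),
    (∀ s ∉ F, S.proj s x = 0) ∧ ∑ s ∈ F, S.proj s x = AddMonoidHom.id S.Product x := by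
  induction x using S.induction with
  | h0 => exact ⟨∅, by simp⟩
  | @h1 e f σ a =>
    refine ⟨{⟨e, f, σ⟩}, fun s hs => ?_, ?_⟩
    · rw [proj_single, if_neg]
      rintro rfl
      simp at hs
    · rw [Finset.sum_singleton, proj_single, if_pos rfl, AddMonoidHom.id_apply]
  | h2 x y hx hy => exact AddMonoidHom.exists_sum_eq_add _ _ hx hy

/-- Only finitely many of the `σ`-components of the multiplication map are nonzero at a given
`z ∈ R ⊗_{R_0} R`, and they add up to `μ(z)`. -/
theorem exists_sum_compMu (z : Tensor S.principal) : ∃ F : Finset (Σ e f : C, (e ⟶ f)),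
    (∀ s ∉ F, S.compMu s z = 0) ∧ ∑ s ∈ F, S.compMu s z = mu S.principal z := by
  induction z using Tensor.induction with
  | h0 => exact ⟨∅, by simp⟩
  | ha x y hx hy => exact AddMonoidHom.exists_sum_eq_add _ _ hx hy
  | ht x y =>
    obtain ⟨F, hF, hF'⟩ := S.exists_sum_proj x
    refine ⟨F, fun s hs => ?_, ?_⟩
    · simp [compMu, hF s hs]
    · simp only [compMu, AddMonoidHom.comp_apply, mapLeft_tmul, mu_tmul]
      rw [← Finset.sum_mul, hF', AddMonoidHom.id_apply]

/-- If `R/R_0` is separable, then the isotropy groups of the groupoid are finite: the `σ` with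
nonzero component at the image of `u_e` under the section form a finite set, which is nonempty
and stable under the free action of the isotropy group of `e`. -/
theorem finite_end_of_isSeparable (h : RingExt.IsSeparable S.principal) (e : C) :
    Finite (e ⟶ e) := by
  obtain ⟨δ, hμ, hl, hr⟩ := h
  set z := δ (S.single (𝟙 e) 1) with hz
  have hez : lact S.principal (S.single (𝟙 e) 1) z = z := by
    rw [hz, ← hl, single_id_mul_single, mul_one]
  obtain ⟨F, hF, hF'⟩ := S.exists_sum_compMu z
  have hne : ∑ s ∈ F, S.compMu s z ≠ 0 := by
    have := S.nontrivial e
    rw [hF', hμ, Ne, map_eq_zero_iff _ (S.single_injective _)]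
    exact one_ne_zero
  obtain ⟨⟨d, f, σ⟩, -, hσ⟩ := Finset.exists_ne_zero_of_sum_ne_zero hne
  obtain rfl : e = f := by
    by_contra hef
    apply hσ
    have h₁ := S.compMu_lact (𝟙 f) 1 σ z
    rw [single_id_mul_compMu, ← hez, ← lact_mul, single_mul_single_zero _ _ _ _ _ hef, lact_zero,
      map_zero, hez] at h₁
    exact h₁.symm
  -- `u_g z = δ(u_g) = z u_g` compares the components of `z` at `σ` and at `gσ`
  have hmove (g : e ⟶ e) : S.compMu ⟨d, e, σ ≫ g⟩ z ≠ 0 := by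
    intro h0
    have h₁ : lact S.principal (S.single g 1) z = ract S.principal (S.single g 1) z := by
      rw [hz, ← hl, ← hr, single_id_mul_single, single_mul_single_id, map_one]
    have h₂ := S.compMu_lact g 1 σ z
    rw [h₁, compMu_ract, h0, zero_mul] at h₂
    obtain ⟨v, hv, -⟩ := S.exists_single_inv g
    apply hσ
    rw [← single_id_mul_compMu, ← hv, mul_assoc, ← h₂, mul_zero]
  have hinj : Function.Injective
      fun g : e ⟶ e => (⟨d, e, σ ≫ g⟩ : Σ e f : C, (e ⟶ f)) := by
    intro g g' hg
    rw [← cancel_epi σ]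
    simpa using hg
  have hmem (g : e ⟶ e) : (⟨d, e, σ ≫ g⟩ : Σ e f : C, (e ⟶ f)) ∈ F := by
    by_contra hg
    exact hmove g (hF _ hg)
  exact Finite.of_injective (fun g => (⟨_, hmem g⟩ : F)) fun g g' hg =>
    hinj (congrArg Subtype.val hg)

/-! ### Sufficiency: a separability section from an element of trace one -/

/-- Let `e₀` be an object with finitely many morphisms to every object, and let `a` be a
central element of `A_{e₀}` with `∑_{σ : e₀ ⟶ e} σ(a) = 1` for all objects `e`. Then `R/R_0` is
separable: with `X_e = ∑_{σ : e₀ ⟶ e} u_σ a ⊗ u_σ⁻¹`, the map `r ↦ r X_{d(σ)}`, for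
`r ∈ A_{r(σ)} u_σ`, is a section of the multiplication map. -/
theorem isSeparable_of_sum_eq_one (e₀ : C) [∀ e, Fintype (e₀ ⟶ e)] (a : A e₀)
    (hcomm : ∀ b, a * b = b * a) (hsum : ∀ e, ∑ σ : e₀ ⟶ e, S.α σ a = 1) :
    RingExt.IsSeparable S.principal := by
  choose v hv₁ hv₂ using fun (e : C) (σ : e₀ ⟶ e) => S.exists_single_inv σ
  let V (e : C) (σ : e₀ ⟶ e) : S.Product := S.single (Groupoid.inv σ) (v e σ)
  let X (e : C) : Tensor S.principal :=
    ∑ σ : e₀ ⟶ e, tmul S.principal (S.single σ 1 * S.single (𝟙 e₀) a) (V e σ)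
  -- `r X_{d(τ)} = X_{r(τ)} r` for `r` in the component of `τ`
  have hcen {e f : C} (τ : e ⟶ f) (t : A f) :
      lact S.principal (S.single τ t) (X e) = ract S.principal (S.single τ t) (X f) := by
    simp only [X, map_sum, lact_tmul, ract_tmul]
    refine Fintype.sum_equiv
      ⟨fun σ => σ ≫ τ, fun σ => σ ≫ Groupoid.inv τ, fun σ => by simp, fun σ => by simp⟩ _ _
      fun σ => ?_
    simp only [Equiv.coe_fn_mk]
    -- `b = u_{τσ}⁻¹ r u_σ` lies in `A_{e₀} u_{e₀}`, and `r u_σ = u_{τσ} b`, `u_{τσ}⁻¹ r = b u_σ⁻¹`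
    obtain ⟨b, hb⟩ : ∃ b, V f (σ ≫ τ) * (S.single τ t * S.single σ 1) = S.single (𝟙 e₀) b := by
      simp only [V, single_mul_single, Groupoid.comp_inv]
      exact ⟨_, rfl⟩
    have h₁ : S.single τ t * S.single σ 1 = S.single (σ ≫ τ) 1 * S.single (𝟙 e₀) b := by
      rw [← hb, ← mul_assoc, hv₂, single_mul_single, single_id_mul_single, one_mul]
    have h₂ : V f (σ ≫ τ) * S.single τ t = S.single (𝟙 e₀) b * V e σ := by
      rw [← hb, mul_assoc, mul_assoc, hv₂, single_mul_single_id, map_one, mul_one]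
    rw [← mul_assoc, h₁, h₂, ← tmul_balanced _ _ _ (S.single_id_mem_principal e₀ b), mul_assoc,
      mul_assoc, single_id_mul_single, single_id_mul_single, hcomm]
  have hcen_zero {d e f : C} (τ : d ⟶ e) (t : A e) (h : e ≠ f) :
      ract S.principal (S.single τ t) (X f) = 0 := by
    simp only [X, map_sum, ract_tmul]
    refine Finset.sum_eq_zero fun σ _ => ?_
    rw [single_mul_single_zero _ _ _ _ _ h, tmul_zero_right]
  have hX (e : C) : mu S.principal (X e) = S.single (𝟙 e) 1 := by
    simp only [X, map_sum, mu_tmul]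
    refine (Finset.sum_congr rfl fun σ _ => ?_).trans
      ((map_sum (S.single (𝟙 e)) _ _).symm.trans (congrArg _ (hsum e)))
    calc S.single σ 1 * S.single (𝟙 e₀) a * V e σ
        = S.single (𝟙 e) (S.α σ a) * S.single σ 1 * V e σ := by
          rw [single_mul_single_id, single_id_mul_single, one_mul, mul_one]
      _ = S.single (𝟙 e) (S.α σ a) := by
          rw [mul_assoc, hv₂, single_id_mul_single, mul_one]
  let δ : S.Product →+ Tensor S.principal := S.liftHom fun s =>
    { toFun := fun t => lact S.principal (S.single s.2.2 t) (X s.1)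
      map_zero' := by simp
      map_add' := fun t t' => by rw [map_add, lact_add] }
  have hδ {e f : C} (τ : e ⟶ f) (t : A f) :
      δ (S.single τ t) = lact S.principal (S.single τ t) (X e) := liftHom_single _ _ _ _
  refine ⟨δ, fun r => ?_, fun c r => ?_, fun r c => ?_⟩
  · induction r using S.induction with
    | h0 => simp
    | h2 x y hx hy => simp only [map_add, hx, hy]
    | h1 τ t => rw [hδ, mu_lact, hX, single_mul_single_id, map_one, mul_one]
  · induction r using S.induction with
    | h0 => simp
    | h2 x y hx hy => simp only [mul_add, map_add, hx, hy]
    | @h1 e f τ t =>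
      rw [hδ, ← lact_mul]
      induction c using S.induction with
      | h0 => simp
      | h2 x y hx hy => simp only [add_mul, map_add, lact_add, hx, hy]
      | @h1 e' f' ρ s =>
        by_cases h : f = e'
        · subst h
          rw [single_mul_single, hδ]
        · rw [single_mul_single_zero _ _ _ _ _ h, map_zero, lact_zero]
  · induction c using S.induction with
    | h0 => simp
    | h2 x y hx hy => simp only [mul_add, map_add, ract_add, hx, hy]
    | @h1 e f τ t =>
      induction r using S.induction with
      | h0 => simp
      | h2 x y hx hy => simp only [add_mul, map_add, hx, hy]
      | @h1 e' f' ρ s =>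
        rw [hδ, ← lact_ract]
        by_cases h : f = e'
        · subst h
          rw [← hcen, ← lact_mul, single_mul_single, hδ]
        · rw [single_mul_single_zero _ _ _ _ _ h, hcen_zero _ _ h, map_zero, map_zero]

end ObjectCrossedSystem

/-! ### The groupoid of conjugate fields -/

/-- The trace of a finite group of automorphisms of a field takes the value `1`, because distinct
automorphisms are linearly independent. -/
theorem AlgEquiv.exists_sum_eq_one (K L : Type*) [Field K] [Field L] [Algebra K L]
    [Fintype (L ≃ₐ[K] L)] : ∃ a : L, ∑ g : L ≃ₐ[K] L, g a = 1 := by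
  obtain ⟨a, ha⟩ : ∃ a : L, ∑ g : L ≃ₐ[K] L, g a ≠ 0 := by
    by_contra! h
    have hli : LinearIndependent L (fun g : L ≃ₐ[K] L => ((g : L →* L) : L → L)) :=
      (linearIndependent_monoidHom L L).comp (fun g : L ≃ₐ[K] L => (g : L →* L)) fun g g' hg =>
        AlgEquiv.ext fun x => DFunLike.congr_fun hg x
    have := Fintype.linearIndependent_iff.1 hli (fun _ => 1) (by
      ext x
      simpa using h x) AlgEquiv.refl
    exact one_ne_zero this
  refine ⟨a / ∑ g : L ≃ₐ[K] L, g a, ?_⟩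
  have hfix (g : L ≃ₐ[K] L) : g (∑ h : L ≃ₐ[K] L, h a) = ∑ h : L ≃ₐ[K] L, h a := by
    rw [map_sum]
    exact Fintype.sum_equiv (Equiv.mulLeft g) _ _ fun h => rfl
  simp only [map_div₀, hfix]
  rw [← Finset.sum_div, div_self ha]

namespace ConjugateField

open CategoryTheory

variable {K L N : Type*} [Field K] [Field L] [Field N] [Algebra K L] [Algebra K N]
  [Algebra L N] [IsScalarTower K L N]

theorem exists_hom_base (i : ConjugateField K L N) : Nonempty (base K L N ⟶ i) := by
  obtain ⟨F, g, rfl⟩ := i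
  exact ⟨⟨IntermediateField.equivMap _ _, g, fun _ => rfl⟩⟩

/-- The isotropy group of a conjugate of `L`, as a set: since `N/K` is normal, every
`K`-automorphism of a conjugate of `L` is a restriction of an automorphism of `N`. -/
noncomputable def endEquiv [Normal K N] (i : ConjugateField K L N) :
    (i ⟶ i) ≃ (i.Carrier ≃ₐ[K] i.Carrier) where
  toFun σ := σ.1
  invFun σ := ⟨σ, σ.liftNormal N, fun x => (σ.liftNormal_commutes N x).symm⟩
  left_inv _ := rfl
  right_inv _ := rfl

/-- The isomorphism of `L` with its copy in `N`. -/
noncomputable def toBaseEquiv (K L N : Type*) [Field K] [Field L] [Field N] [Algebra K L]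
    [Algebra K N] [Algebra L N] [IsScalarTower K L N] : L ≃ₐ[K] (base K L N).Carrier :=
  AlgEquiv.ofInjectiveField (IsScalarTower.toAlgHom K L N)

theorem finite_end_base_iff [Normal K N] :
    Finite (base K L N ⟶ base K L N) ↔ Finite (L ≃ₐ[K] L) :=
  ((endEquiv (base K L N)).trans (toBaseEquiv K L N).autCongr.symm.toEquiv).finite_iff

theorem eq_base [Normal K L] [Normal K N] (i : ConjugateField K L N) : i = base K L N := by
  obtain ⟨F, g, rfl⟩ := i
  have : Normal K (IsScalarTower.toAlgHom K L N).fieldRange :=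
    Normal.of_algEquiv (toBaseEquiv K L N)
  exact Subtype.ext (IntermediateField.normal_iff_forall_map_eq.1 this _)

end ConjugateField

theorem IsGalois.finite_algEquiv_iff_finiteDimensional (K L : Type*) [Field K] [Field L]
    [Algebra K L] [IsGalois K L] : Finite (L ≃ₐ[K] L) ↔ FiniteDimensional K L := by
  refine ⟨fun _ => ?_, fun _ => inferInstance⟩
  -- the Krull topology on a finite Galois group is discrete
  have h := (InfiniteGalois.isOpen_iff_finite (⊤ : IntermediateField K L)).1
    (isOpen_discrete _)
  exact IntermediateField.topEquiv.toLinearEquiv.finiteDimensional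

namespace FieldCocycle

open CategoryTheory ConjugateField

variable {K L N : Type*} [Field K] [Field L] [Field N] [Algebra K L] [Algebra K N]
  [Algebra L N] [IsScalarTower K L N] (c : FieldCocycle K L N)

theorem isSeparable_of_finite [Normal K N] [Finite (L ≃ₐ[K] L)] :
    RingExt.IsSeparable c.system.principal := by
  have hfin : Finite (base K L N ⟶ base K L N) := finite_end_base_iff.2 ‹_›
  -- composition with one morphism `base ⟶ i` is a bijection from the isotropy group
  let shift {i : ConjugateField K L N} (τ : base K L N ⟶ i) :
      (base K L N ⟶ base K L N) ≃ (base K L N ⟶ i) :=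
    ⟨fun σ => σ ≫ τ, fun σ => σ ≫ Groupoid.inv τ, fun σ => by simp, fun σ => by simp⟩
  have (i : ConjugateField K L N) : Finite (base K L N ⟶ i) :=
    (exists_hom_base i).elim fun τ => Finite.of_equiv _ (shift τ)
  have (i : ConjugateField K L N) : Fintype (base K L N ⟶ i) := Fintype.ofFinite _
  have : Fintype ((base K L N).Carrier ≃ₐ[K] (base K L N).Carrier) :=
    Fintype.ofEquiv _ (endEquiv (base K L N))
  obtain ⟨a, ha⟩ := AlgEquiv.exists_sum_eq_one K (base K L N).Carrier
  refine c.system.isSeparable_of_sum_eq_one (base K L N) a (fun b => mul_comm a b) fun i => ?_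
  obtain ⟨τ⟩ := exists_hom_base i
  rw [← map_one τ.1, ← ha, map_sum]
  exact (Fintype.sum_equiv ((endEquiv (base K L N)).symm.trans (shift τ)) _ _ fun σ => rfl).symm

theorem isSeparable_iff [Normal K N] :
    RingExt.IsSeparable c.system.principal ↔ Finite (L ≃ₐ[K] L) :=
  ⟨fun h => finite_end_base_iff.1 (c.system.finite_end_of_isSeparable h (base K L N)),
    fun _ => c.isSeparable_of_finite⟩

/-- If `L/K` is normal, then `L` is its only conjugate, so that `R_0` is a copy of `L`. -/
theorem exists_ringEquiv_principal [Normal K L] [Normal K N] :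
    ∃ φ : L ≃+* c.system.principal, ∀ x : L,
      (φ x : c.Crossed) = c.system.single (𝟙 (base K L N)) (toBase K N x) := by
  let φ : L →ₙ+* c.system.principal :=
    { toFun := fun x => ⟨_, c.system.single_id_mem_principal (base K L N) (toBaseEquiv K L N x)⟩
      map_zero' := Subtype.ext (by simp)
      map_add' := fun x y => Subtype.ext (by simp)
      map_mul' := fun x y => Subtype.ext (by
        simp [ObjectCrossedSystem.single_id_mul_single]) }
  refine ⟨RingEquiv.ofBijective φ ⟨fun x y h => ?_, fun ⟨r, hr⟩ => ?_⟩, fun x => rfl⟩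
  · exact (toBaseEquiv K L N).injective
      (c.system.single_injective _ (congrArg Subtype.val h))
  · change r ∈ (⨆ e, (c.system.single (𝟙 e)).range : AddSubgroup c.Crossed) at hr
    have hle : (⨆ e, (c.system.single (𝟙 e)).range : AddSubgroup c.Crossed) ≤
        (c.system.single (𝟙 (base K L N))).range :=
      iSup_le fun e => by rw [eq_base e]
    obtain ⟨y, rfl⟩ := hle hr
    exact ⟨(toBaseEquiv K L N).symm y, Subtype.ext
      (congrArg (c.system.single (𝟙 (base K L N))) ((toBaseEquiv K L N).apply_symm_apply y))⟩

end FieldCocycle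

open CategoryTheory in
theorem theorem3 {K L N : Type*} [Field K] [Field L] [Field N] [Algebra K L] [Algebra K N]
    [Algebra L N] [IsScalarTower K L N] [IsNormalClosure K L N] [Algebra.IsSeparable K L]
    (c : FieldCocycle K L N) :
    (RingExt.IsSeparable c.system.principal ↔ Finite (L ≃ₐ[K] L)) ∧
    (IsGalois K L →
      (∃ φ : L ≃+* c.system.principal, ∀ x : L, (φ x : c.Crossed) =
        c.system.single (𝟙 (ConjugateField.base K L N)) (ConjugateField.toBase K N x)) ∧
      (RingExt.IsSeparable c.system.principal ↔ FiniteDimensional K L)) := by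
  have : Normal K N := IsNormalClosure.normal (K := L)
  refine ⟨c.isSeparable_iff, fun _ => ⟨c.exists_ringEquiv_principal, ?_⟩⟩
  rw [c.isSeparable_iff, IsGalois.finite_algEquiv_iff_finiteDimensional]
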